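/- Let $d\ge 0$, let $\|\cdot\|$ be any norm on $\mathbb{R}^d$, let $\epsilon\ge 0$, and let $\mathbb{P}_0,\mathbb{P}_1$ be finite Borel measures on $\mathbb{R}^d$. For $A\subseteq\mathbb{R}^d$ write $A^\epsilon=A\oplus\overline{B_\epsilon(\mathbf 0)}$, $A^{-\epsilon}=((A^C)^\epsilon)^C$, and \[R^\epsilon(A)=\int \mathbf 1_{(A^C)^\epsilon}\,d\mathbb{P}_1+\int \mathbf 1_{A^\epsilon}\,d\mathbb{P}_0 ,\] where the integrals are taken with respect to the completed measures; $R^\epsilon(A)$ is defined if $(A^C)^\epsilon$ and $A^\epsilon$ are measurable for the completions of $\mathbb{P}_1$ and $\mathbb{P}_0$ respectively (this holds for every Borel set $A$). A set $A$ is an adversarial Bayes classifier if $R^\epsilon(A)$ is defined and $R^\epsilon(A)=\inf_{B\text{ Borel}}R^\epsilon(B)$. Two adversarial Bayes classifiers $A_1,A_2$ are equivalent up to degeneracy if every set $E$ for which $R^\epsilon(E)$ is defined (in particular, every Borel set $E$) and $A_1\cap A_2\subseteq E\subseteq A_1\cup A_2$ is also an adversarial Bayes classifier. Theorem. Let $A$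 be an adversarial Bayes classifier. Then $A$ is equivalent up to degeneracy to a Borel adversarial Bayes classifier $A_1$ with $A_1=C^\epsilon$ for some set $C$, and to a Borel adversarial Bayes classifier $A_2$ with $A_2^C=E^\epsilon$ for some set $E$. Moreover, $A$ is equivalent up to degeneracy to $(A^{-\epsilon})^\epsilon$, and to $(A^\epsilon)^{-\epsilon}$, whose complement is $((A^\epsilon)^C)^\epsilon$; in particular, both of these sets are adversarial Bayes classifiers. -/

import Mathlib

open MeasureTheory Set
open scoped ENNReal Pointwise

section AdversarialBayes

variable {V : Type*} [NormedAddCommGroup V]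

/-- The `ε`-expansion `A^ε = A ⊕ closedBall 0 ε` of a set `A`. -/
def expansion (ε : ℝ) (A : Set V) : Set V := A + Metric.closedBall (0 : V) ε

/-- The set `A^{-ε} = ((Aᶜ)^ε)ᶜ`. -/
def erosion (ε : ℝ) (A : Set V) : Set V := (expansion ε Aᶜ)ᶜ

variable [MeasurableSpace V]

/-- The adversarial risk of `A` is defined: `1_{A^ε}` is measurable for the completion of `P₀` and
`1_{(Aᶜ)^ε}` is measurable for the completion of `P₁`.  Every Borel set has this property, see
`MeasurableSet.hasAdversarialRisk`. -/
def HasAdversarialRisk (P₀ P₁ : Measure V) (ε : ℝ) (A : Set V) : Prop :=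
  NullMeasurableSet (expansion ε A) P₀ ∧ NullMeasurableSet (expansion ε Aᶜ) P₁

/-- The adversarial classification risk `R^ε(A) = ∫ 1_{(Aᶜ)^ε} dP₁ + ∫ 1_{A^ε} dP₀`, the integrals
being taken with respect to the completed measures.  (In Mathlib, the value of a measure on a null
measurable set is the value of its completion.) -/
noncomputable def adversarialRisk (P₀ P₁ : Measure V) (ε : ℝ) (A : Set V) : ℝ≥0∞ :=
  P₁ (expansion ε Aᶜ) + P₀ (expansion ε A)

/-- An adversarial Bayes classifier: a set `A` whose adversarial risk is defined and equal to the
minimal value of the adversarial risk over the Borel sets. -/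
def IsAdversarialBayes (P₀ P₁ : Measure V) (ε : ℝ) (A : Set V) : Prop :=
  HasAdversarialRisk P₀ P₁ ε A ∧
    adversarialRisk P₀ P₁ ε A = ⨅ (B : Set V) (_ : MeasurableSet B), adversarialRisk P₀ P₁ ε B

/-- Two adversarial Bayes classifiers are equivalent up to degeneracy if every set `E` (Borel, or
more generally with a defined adversarial risk) that lies between their intersection and their
union is an adversarial Bayes classifier as well. -/
def EquivalentUpToDegeneracy (P₀ P₁ : Measure V) (ε : ℝ) (A₁ A₂ : Set V) : Prop :=
  IsAdversarialBayes P₀ P₁ ε A₁ ∧ IsAdversarialBayes P₀ P₁ ε A₂ ∧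
    ∀ E : Set V, HasAdversarialRisk P₀ P₁ ε E → A₁ ∩ A₂ ⊆ E → E ⊆ A₁ ∪ A₂ →
      IsAdversarialBayes P₀ P₁ ε E

end AdversarialBayes

/-- Analytic sets are measurable for the completion of every finite Borel measure. -/
theorem MeasureTheory.AnalyticSet.nullMeasurableSet {X : Type*} [TopologicalSpace X]
    [TopologicalSpace.MetrizableSpace X] [MeasurableSpace X] [BorelSpace X] {s : Set X}
    (hs : AnalyticSet s) (μ : Measure X) [IsFiniteMeasure μ] : NullMeasurableSet s μ := by
  rw [AnalyticSet] at hs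
  rcases hs with rfl | ⟨f, hf, rfl⟩
  · exact MeasurableSet.empty.nullMeasurableSet
  have key : ∀ c : ℝ≥0∞, c < μ (range f) → ∃ K ⊆ range f, IsCompact K ∧ c ≤ μ K := by
    intro c hc
    let box : ℕ → (ℕ → ℕ) → Set (ℕ → ℕ) := fun k n => {x | ∀ i < k, x i ≤ n i}
    have step : ∀ k (n : ℕ → ℕ), c < μ (f '' box k n) →
        ∃ m, c < μ (f '' box (k+1) (Function.update n k m)) := by
      intro k n h
      have hU : f '' box k n = ⋃ m, f '' box (k+1) (Function.update n k m) := by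
        rw [← image_iUnion]
        congr 1
        ext x
        simp only [box, mem_ofPred_eq, mem_iUnion]
        constructor
        · intro hx
          refine ⟨x k, fun i hi => ?_⟩
          rcases Nat.lt_succ_iff_lt_or_eq.1 hi with hi | rfl
          · rw [Function.update_of_ne hi.ne]; exact hx i hi
          · simp
        · rintro ⟨m, hm⟩ i hi
          have := hm i (by omega)
          rwa [Function.update_of_ne hi.ne] at this
      have hmono : Monotone fun m => f '' box (k+1) (Function.update n k m) := by
        intro a b hab
        apply image_mono
        intro x hx i hi
        refine (hx i hi).trans ?_
        by_cases h : i = k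
        · subst h; simpa using hab
        · simp [Function.update_of_ne h]
      rw [hU, hmono.measure_iUnion] at h
      exact lt_iSup_iff.1 h
    choose! g hg using step
    let N : ℕ → (ℕ → ℕ) := fun k => Nat.rec (fun _ => 0) (fun k n => Function.update n k (g k n)) k
    have hN0 : ∀ k, N (k+1) = Function.update (N k) k (g k (N k)) := fun k => rfl
    have hN : ∀ k, c < μ (f '' box k (N k)) := by
      intro k
      induction k with
      | zero => simpa [box] using hc
      | succ k ih => rw [hN0]; exact hg k _ ih
    let b : ℕ → ℕ := fun i => N (i+1) i
    have hst : ∀ i k, i < k → N k i = b i := by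
      intro i k hik
      induction k with
      | zero => omega
      | succ k ih =>
        rcases Nat.lt_succ_iff_lt_or_eq.1 hik with h | rfl
        · rw [hN0, Function.update_of_ne h.ne, ih h]
        · rfl
    have hb : ∀ k, c < μ (f '' box k b) := by
      intro k
      have : box k b = box k (N k) := by
        ext x
        simp only [box, mem_ofPred_eq]
        exact forall₂_congr fun i hi => by rw [hst i k hi]
      rw [this]; exact hN k
    let L : Set (ℕ → ℕ) := Set.pi univ fun i => Iic (b i)
    have hL : IsCompact L := isCompact_univ_pi fun i => (finite_Iic _).isCompact
    refine ⟨f '' L, image_subset_range _ _, hL.image hf, ?_⟩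
    by_contra! hlt
    obtain ⟨U, hLU, hUo, hU⟩ := Set.exists_isOpen_lt_of_lt (f '' L) c hlt
    have hpre : L ⊆ f ⁻¹' U := image_subset_iff.1 hLU
    obtain ⟨k, hk⟩ : ∃ k, box k b ⊆ f ⁻¹' U := by
      by_contra! hno
      simp only [not_subset] at hno
      choose x hxb hxU using hno
      let y : ℕ → (ℕ → ℕ) := fun k i => min (x k i) (b i)
      have hyL : ∀ k, y k ∈ L := fun k i _ => mem_Iic.2 (min_le_right _ _)
      obtain ⟨z, hzL, φ, hφ, hz⟩ := hL.tendsto_subseq hyL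
      have hx : Filter.Tendsto (fun k => x (φ k)) Filter.atTop (nhds z) := by
        rw [tendsto_pi_nhds] at hz ⊢
        intro i
        refine (hz i).congr' ?_
        filter_upwards [Filter.eventually_gt_atTop i] with k hk
        exact min_eq_left (hxb (φ k) i (hk.trans_le (hφ.id_le k)))
      have hev := hx.eventually ((hUo.preimage hf).mem_nhds (hpre hzL))
      obtain ⟨k, hk⟩ := hev.exists
      exact hxU _ hk
    exact absurd ((hb k).le.trans (measure_mono (image_subset_iff.2 hk))) hU.not_ge
  rcases eq_or_ne (μ (range f)) 0 with h0 | h0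
  · exact NullMeasurableSet.of_null h0
  obtain ⟨u, -, hu, hut⟩ := exists_seq_strictMono_tendsto' (pos_iff_ne_zero.2 h0)
  choose K hKs hKc hKm using fun n => key (u n) (hu n).2
  have hm : MeasurableSet (⋃ n, K n) := .iUnion fun n => (hKc n).measurableSet
  have hle : μ (range f) ≤ μ (⋃ n, K n) :=
    le_of_tendsto' hut fun n => (hKm n).trans (measure_mono (subset_iUnion _ _))
  exact hm.nullMeasurableSet.congr
    (ae_eq_of_subset_of_measure_ge (iUnion_subset hKs) hle hm.nullMeasurableSet
      (measure_ne_top _ _))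

/-- The adversarial risk of a Borel set is defined. -/
theorem MeasurableSet.hasAdversarialRisk {V : Type*} [NormedAddCommGroup V] [NormedSpace ℝ V]
    [FiniteDimensional ℝ V] [MeasurableSpace V] [BorelSpace V] (P₀ P₁ : Measure V)
    [IsFiniteMeasure P₀] [IsFiniteMeasure P₁] (ε : ℝ) {A : Set V} (hA : MeasurableSet A) :
    HasAdversarialRisk P₀ P₁ ε A := by
  have : ProperSpace V := FiniteDimensional.proper ℝ V
  have h : ∀ B : Set V, MeasurableSet B → AnalyticSet (expansion ε B) := by
    intro B hB
    have hp : MeasurableSet (B ×ˢ Metric.closedBall (0 : V) ε) :=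
      hB.prod Metric.isClosed_closedBall.measurableSet
    rw [expansion, ← Set.add_image_prod]
    exact hp.analyticSet.image_of_continuous continuous_add
  exact ⟨(h A hA).nullMeasurableSet P₀, (h Aᶜ hA.compl).nullMeasurableSet P₁⟩

section Expansion

variable {V : Type*} [NormedAddCommGroup V] {ε : ℝ}

/-! Replacing `A` by its opening `(A^{-ε})^ε ⊆ A` shrinks `A^ε` and leaves `(Aᶜ)^ε` unchanged, so
the risk cannot increase. Minimality is only known against Borel sets, so `A^{-ε}` is first replaced
by a σ-compact `C` inside it of full `P₁`-measure; then `C^ε` is Borel. Minimality makes the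
expansions of `C^ε` and `A`, and of their complements, agree almost everywhere, and every set in
between, such as the opening, is squeezed (`IsAdversarialBayes.exists_expansion`). The closing
follows by taking complements and swapping `P₀` with `P₁`. -/

theorem expansion_mono {A B : Set V} (h : A ⊆ B) : expansion ε A ⊆ expansion ε B :=
  Set.add_subset_add_right h

theorem expansion_iUnion {ι : Sort*} (K : ι → Set V) :
    expansion ε (⋃ i, K i) = ⋃ i, expansion ε (K i) :=
  Set.iUnion_add _ _

theorem erosion_compl (A : Set V) : erosion ε Aᶜ = (expansion ε A)ᶜ := by
  rw [erosion, compl_compl]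

theorem compl_erosion (A : Set V) : (erosion ε A)ᶜ = expansion ε Aᶜ :=
  compl_compl _

/-- Expansion is left adjoint to erosion. -/
theorem expansion_subset_iff {A B : Set V} : expansion ε A ⊆ B ↔ A ⊆ erosion ε B := by
  simp only [expansion, erosion, Set.subset_def, Set.mem_compl_iff, Set.mem_add,
    mem_closedBall_zero_iff]
  constructor
  · rintro h x hx ⟨y, hy, z, hz, rfl⟩
    exact hy (h y ⟨_, hx, -z, by rwa [norm_neg], by abel⟩)
  · rintro h x ⟨y, hy, z, hz, rfl⟩
    by_contra hx
    exact h y hy ⟨_, hx, -z, by rwa [norm_neg], by abel⟩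

theorem expansion_erosion_subset (A : Set V) : expansion ε (erosion ε A) ⊆ A :=
  expansion_subset_iff.2 subset_rfl

theorem IsCompact.expansion [ProperSpace V] {K : Set V} (hK : IsCompact K) :
    IsCompact (expansion ε K) :=
  hK.add (isCompact_closedBall _ _)

end Expansion

/-- A null measurable set contains a σ-compact set of full measure. -/
theorem MeasureTheory.NullMeasurableSet.exists_iUnion_isCompact_ae_eq {X : Type*}
    [TopologicalSpace X] [T2Space X] [MeasurableSpace X] [OpensMeasurableSpace X] {μ : Measure X}
    [IsFiniteMeasure μ] [μ.InnerRegularCompactLTTop] {s : Set X} (hs : NullMeasurableSet s μ) :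
    ∃ K : ℕ → Set X, (∀ n, IsCompact (K n)) ∧ (⋃ n, K n) ⊆ s ∧ (⋃ n, K n) =ᵐ[μ] s := by
  obtain ⟨t, hts, ht, hteq⟩ := hs.exists_measurable_subset_ae_eq
  have key : ∀ n : ℕ, ∃ K ⊆ t, IsCompact K ∧ μ t < μ K + ((n : ℝ≥0∞) + 1)⁻¹ := fun n =>
    ht.exists_isCompact_lt_add (measure_ne_top _ _) (by simp)
  choose K hKt hK hKμ using key
  refine ⟨K, hK, (iUnion_subset hKt).trans hts, Filter.EventuallyEq.trans ?_ hteq⟩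
  refine ae_eq_of_subset_of_measure_ge (iUnion_subset hKt) ?_
    (MeasurableSet.iUnion fun n => (hK n).measurableSet).nullMeasurableSet (measure_ne_top _ _)
  have hlim : Filter.Tendsto (fun n : ℕ => μ (⋃ n, K n) + ((n : ℝ≥0∞) + 1)⁻¹) Filter.atTop
      (nhds (μ (⋃ n, K n) + 0)) := by
    refine Filter.Tendsto.const_add _ ?_
    simpa using (Filter.tendsto_add_atTop_iff_nat 1).2 ENNReal.tendsto_inv_nat_nhds_zero
  rw [add_zero] at hlim
  exact ge_of_tendsto' hlim fun n =>
    (hKμ n).le.trans (add_le_add_left (measure_mono (subset_iUnion _ _)) _)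

theorem ae_eq_of_subset_of_subset {X : Type*} [MeasurableSpace X] {μ : Measure X} {s t u : Set X}
    (hst : s ⊆ t) (htu : t ⊆ u) (h : s =ᵐ[μ] u) : t =ᵐ[μ] u :=
  htu.eventuallyLE.antisymm (h.symm.le.trans hst.eventuallyLE)

section Risk

variable {V : Type*} [NormedAddCommGroup V] [MeasurableSpace V] {P₀ P₁ : Measure V} {ε : ℝ}
  {A B : Set V}

theorem adversarialRisk_compl (A : Set V) :
    adversarialRisk P₁ P₀ ε Aᶜ = adversarialRisk P₀ P₁ ε A := by
  rw [adversarialRisk, adversarialRisk, compl_compl, add_comm]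

theorem HasAdversarialRisk.compl (h : HasAdversarialRisk P₀ P₁ ε A) :
    HasAdversarialRisk P₁ P₀ ε Aᶜ :=
  ⟨h.2, by rw [compl_compl]; exact h.1⟩

theorem IsAdversarialBayes.compl (h : IsAdversarialBayes P₀ P₁ ε A) :
    IsAdversarialBayes P₁ P₀ ε Aᶜ := by
  refine ⟨h.1.compl, (adversarialRisk_compl A).trans (h.2.trans (le_antisymm ?_ ?_))⟩
  · refine le_iInf₂ fun B hB => (iInf₂_le Bᶜ hB.compl).trans_eq ?_
    exact adversarialRisk_compl B
  · refine le_iInf₂ fun B hB => (iInf₂_le Bᶜ hB.compl).trans_eq ?_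
    exact adversarialRisk_compl B

theorem EquivalentUpToDegeneracy.compl (h : EquivalentUpToDegeneracy P₀ P₁ ε A B) :
    EquivalentUpToDegeneracy P₁ P₀ ε Aᶜ Bᶜ := by
  refine ⟨h.1.compl, h.2.1.compl, fun E hE hl hu => ?_⟩
  have h' := h.2.2 Eᶜ hE.compl ?_ ?_
  · simpa using h'.compl
  · rwa [subset_compl_comm, compl_inter]
  · rwa [compl_subset_comm, compl_union]

theorem IsAdversarialBayes.of_ae_eq (hA : IsAdversarialBayes P₀ P₁ ε A)
    (h₀ : expansion ε B =ᵐ[P₀] expansion ε A) (h₁ : expansion ε Bᶜ =ᵐ[P₁] expansion ε Aᶜ) :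
    IsAdversarialBayes P₀ P₁ ε B := by
  refine ⟨⟨hA.1.1.congr h₀.symm, hA.1.2.congr h₁.symm⟩, ?_⟩
  rw [← hA.2, adversarialRisk, adversarialRisk, measure_congr h₀, measure_congr h₁]

/-- An adversarial Bayes classifier `A` contains the expansion of a σ-compact set, which is Borel,
such that every set in between is an adversarial Bayes classifier. -/
theorem IsAdversarialBayes.exists_expansion [NormedSpace ℝ V] [FiniteDimensional ℝ V]
    [BorelSpace V] [IsFiniteMeasure P₀] [IsFiniteMeasure P₁] (hA : IsAdversarialBayes P₀ P₁ ε A) :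
    ∃ C ⊆ erosion ε A, MeasurableSet (expansion ε C) ∧
      ∀ E, expansion ε C ⊆ E → E ⊆ A → IsAdversarialBayes P₀ P₁ ε E := by
  have : ProperSpace V := FiniteDimensional.proper ℝ V
  obtain ⟨K, hK, hKA, hKeq⟩ := hA.1.2.compl.exists_iUnion_isCompact_ae_eq
  set C := ⋃ n, K n
  have hsub : expansion ε C ⊆ A := expansion_subset_iff.2 hKA
  have hm : MeasurableSet (expansion ε C) := by
    rw [expansion_iUnion]
    exact .iUnion fun n => (hK n).expansion.measurableSet
  have hm₂ : MeasurableSet (expansion ε (expansion ε C)) := by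
    rw [expansion_iUnion, expansion_iUnion]
    exact .iUnion fun n => (hK n).expansion.expansion.measurableSet
  have hC : expansion ε (expansion ε C)ᶜ ⊆ Cᶜ := by
    rw [← compl_erosion, compl_subset_compl]
    exact expansion_subset_iff.1 subset_rfl
  have hCeq : expansion ε Aᶜ =ᵐ[P₁] (Cᶜ : Set V) := by
    simpa using hKeq.symm.compl
  have h₀ : expansion ε (expansion ε C) =ᵐ[P₀] expansion ε A := by
    refine ae_eq_of_subset_of_measure_ge (expansion_mono hsub) ?_ hm₂.nullMeasurableSet
      (measure_ne_top _ _)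
    have hle : adversarialRisk P₀ P₁ ε A ≤ adversarialRisk P₀ P₁ ε (expansion ε C) :=
      hA.2.trans_le (iInf₂_le _ hm)
    -- Adding the finite term `P₁((Aᶜ)^ε) = P₁(Cᶜ)`, which bounds the `P₁` part of the risk of
    -- `C^ε`, reduces the claim to minimality of `A`.
    refine (ENNReal.add_le_add_iff_left (measure_ne_top P₁ (expansion ε Aᶜ))).1 (hle.trans ?_)
    rw [adversarialRisk, measure_congr hCeq]
    gcongr
  refine ⟨C, hKA, hm, fun E hCE hEA => hA.of_ae_eq ?_ ?_⟩
  · exact ae_eq_of_subset_of_subset (expansion_mono hCE) (expansion_mono hEA) h₀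
  -- Squeeze: `(Aᶜ)^ε ⊆ (Eᶜ)^ε ⊆ ((C^ε)ᶜ)^ε ⊆ Cᶜ`, with equal ends up to a `P₁`-null set.
  · refine (ae_eq_of_subset_of_subset (expansion_mono (compl_subset_compl.2 hEA)) ?_ hCeq).trans
      hCeq.symm
    exact (expansion_mono (compl_subset_compl.2 hCE)).trans hC

theorem IsAdversarialBayes.equivalent_expansion [NormedSpace ℝ V] [FiniteDimensional ℝ V]
    [BorelSpace V] [IsFiniteMeasure P₀] [IsFiniteMeasure P₁] (hA : IsAdversarialBayes P₀ P₁ ε A) :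
    (∃ C, MeasurableSet (expansion ε C) ∧
      EquivalentUpToDegeneracy P₀ P₁ ε A (expansion ε C)) ∧
      EquivalentUpToDegeneracy P₀ P₁ ε A (expansion ε (erosion ε A)) := by
  obtain ⟨C, hCA, hm, hC⟩ := hA.exists_expansion
  have equiv : ∀ B, expansion ε C ⊆ B → B ⊆ A → EquivalentUpToDegeneracy P₀ P₁ ε A B := by
    -- As `B ⊆ A`, the sets between `A ∩ B` and `A ∪ B` lie between `C^ε` and `A`.
    refine fun B hCB hBA => ⟨hA, hC B hCB hBA, fun E _ hl hu => hC E ?_ ?_⟩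
    · exact hCB.trans ((subset_inter hBA subset_rfl).trans hl)
    · exact hu.trans (union_subset subset_rfl hBA)
  exact ⟨⟨C, hm, equiv _ subset_rfl (expansion_subset_iff.2 hCA)⟩,
    equiv _ (expansion_mono hCA) (expansion_erosion_subset A)⟩

end Risk

theorem mainTheorem8 {V : Type*} [NormedAddCommGroup V] [NormedSpace ℝ V] [FiniteDimensional ℝ V]
    [MeasurableSpace V] [BorelSpace V] (P₀ P₁ : Measure V) [IsFiniteMeasure P₀]
    [IsFiniteMeasure P₁] (ε : ℝ) (hε : 0 ≤ ε) (A : Set V) (hA : IsAdversarialBayes P₀ P₁ ε A) :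
    (∃ A₁ C : Set V, MeasurableSet A₁ ∧ A₁ = expansion ε C ∧
        EquivalentUpToDegeneracy P₀ P₁ ε A A₁) ∧
      (∃ A₂ E : Set V, MeasurableSet A₂ ∧ A₂ᶜ = expansion ε E ∧
        EquivalentUpToDegeneracy P₀ P₁ ε A A₂) ∧
      EquivalentUpToDegeneracy P₀ P₁ ε A (expansion ε (erosion ε A)) ∧
      (erosion ε (expansion ε A))ᶜ = expansion ε (expansion ε A)ᶜ ∧
      EquivalentUpToDegeneracy P₀ P₁ ε A (erosion ε (expansion ε A)) := by
  obtain ⟨⟨C, hCm, hC⟩, hop⟩ := hA.equivalent_expansion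
  -- The opening of `Aᶜ` is the complement of the closing of `A`.
  obtain ⟨⟨E, hEm, hE⟩, hcl⟩ := hA.compl.equivalent_expansion
  refine ⟨⟨_, C, hCm, rfl, hC⟩, ⟨(expansion ε E)ᶜ, E, hEm.compl, compl_compl _, ?_⟩, hop,
    compl_erosion _, ?_⟩
  · simpa using hE.compl
  · have h := hcl.compl
    rwa [compl_compl, erosion_compl] at h
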